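/- Let $\mathbb{F}_q$ be a finite field and let $m,n\ge 1$. A $t$-query quantum matrix-vector (MV) algorithm acts on the space with orthonormal basis $|x,y,w\rangle$, where $x\in\mathbb{F}_q^n$, $y\in\mathbb{F}_q^m$ and $w$ ranges over a finite set of workspace labels. It starts in a unit vector, alternates $t$ applications of the oracle $U(M)\colon|x,y,w\rangle\mapsto|x,y+Mx,w\rangle$ with arbitrary unitary operators, measures in the basis, and outputs a function of the measurement result; nothing except the oracle depends on the input $M\in\mathbb{F}_q^{m\times n}$. It computes a function $f$ on $\mathbb{F}_q^{m\times n}$ with error $\varepsilon$ if for every $M$ it outputs $f(M)$ with probability at least $1-\varepsilon$. Let $Q_\varepsilon(f)$ be the least $t$ for which such an algorithm exists. Corollary. The bounded-error quantum MV query complexity of computing the rank of an $m\times n$ matrix over $\mathbb{F}_q$ is $\Theta(\min\{m,n\})$. That is, for every fixed $\varepsilon\in[0,1/2)$ there are constants $c,C>0$, depending only on $\varepsilon$, such that for every finite field $\mathbb{F}_q$ and all integers $m,n\ge1$ there is an MV algorithm computing the rank of $m\times n$ matrices over $\mathbb{F}_q$ with error $\varepsilon$, and $$c\,\min\{m,n\}\;\le\;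 Q_\varepsilon(\mathrm{rank})\;\le\; C\,\min\{m,n\}.$$ -/

import Mathlib

open scoped Matrix

universe u

noncomputable section

/-- Computational basis of the register space: a query register holding `x ∈ F^n`, an answer
register holding `y ∈ F^m`, and a workspace with a finite set `W` of basis labels. -/
abbrev MVBasis (F : Type u) (m n : ℕ) (W : Type u) : Type u :=
  (Fin n → F) × (Fin m → F) × W

/-- The Hilbert space of all the registers. -/
abbrev MVSpace (F : Type u) [Fintype F] (m n : ℕ) (W : Type u) [Fintype W] : Type u :=
  EuclideanSpace ℂ (MVBasis F m n W)

/-- The permutation `(x, y, w) ↦ (x, y + M x, w)` of the computational basis. -/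
def mvPerm {F : Type u} [Field F] {m n : ℕ} (W : Type u) (M : Matrix (Fin m) (Fin n) F) :
    MVBasis F m n W ≃ MVBasis F m n W where
  toFun b := (b.1, b.2.1 + M *ᵥ b.1, b.2.2)
  invFun b := (b.1, b.2.1 - M *ᵥ b.1, b.2.2)
  left_inv b := by simp
  right_inv b := by simp

/-- The matrix-vector oracle: the unitary operator with `|x, y, w⟩ ↦ |x, y + M x, w⟩`. -/
def mvOracle {F : Type u} [Field F] [Fintype F] {m n : ℕ} (W : Type u) [Fintype W]
    (M : Matrix (Fin m) (Fin n) F) : MVSpace F m n W ≃ₗᵢ[ℂ] MVSpace F m n W :=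
  LinearIsometryEquiv.piLpCongrLeft 2 ℂ ℂ (mvPerm W M)

/-- A quantum algorithm with output in `α` and oracle access to an unknown `m × n` matrix over
`F` by matrix-vector products. It starts in a unit vector `init`, makes `queries` queries, and
applies the unitary operator `gate k` right after query number `k` (counted from `0`; the gates
with `queries ≤ k` are never used). All registers are then measured in the computational basis,
and `output` is applied to the result. None of these data depends on the matrix. -/
structure MVAlgorithm (F : Type u) [Field F] [Fintype F] (m n : ℕ) (α : Type) where
  W : Type u
  [fintypeW : Fintype W]
  queries : ℕ
  init : MVSpace F m n W
  norm_init : ‖init‖ = 1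
  gate : ℕ → (MVSpace F m n W ≃ₗᵢ[ℂ] MVSpace F m n W)
  output : MVBasis F m n W → α

attribute [instance] MVAlgorithm.fintypeW

namespace MVAlgorithm

variable {F : Type u} [Field F] [Fintype F] {m n : ℕ} {α : Type}

/-- The state after the first `k` queries, each followed by its gate, on the input `M`. -/
def state (A : MVAlgorithm F m n α) (M : Matrix (Fin m) (Fin n) F) : ℕ → MVSpace F m n A.W
  | 0 => A.init
  | k + 1 => A.gate k (mvOracle A.W M (A.state M k))

open scoped Classical in
/-- The probability that the algorithm outputs `a` on the input `M`. -/
def prob (A : MVAlgorithm F m n α) (M : Matrix (Fin m) (Fin n) F) (a : α) : ℝ :=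
  ∑ b : MVBasis F m n A.W, if A.output b = a then ‖A.state M A.queries b‖ ^ 2 else 0

/-- On every input matrix the algorithm outputs `f M` with probability at least `1 - ε`. -/
def Computes (A : MVAlgorithm F m n α) (f : Matrix (Fin m) (Fin n) F → α) (ε : ℝ) : Prop :=
  ∀ M : Matrix (Fin m) (Fin n) F, 1 - ε ≤ A.prob M (f M)

end MVAlgorithm

/-- The numbers of queries with which some quantum algorithm computes `f` with error at most
`ε`. -/
def mvQueryCounts {F : Type u} [Field F] [Fintype F] {m n : ℕ} {α : Type}
    (f : Matrix (Fin m) (Fin n) F → α) (ε : ℝ) : Set ℕ :=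
  {t | ∃ A : MVAlgorithm F m n α, A.queries = t ∧ A.Computes f ε}

/-- The `ε`-error quantum matrix-vector query complexity of `f`, provided that the set
`mvQueryCounts f ε` is nonempty. -/
def mvQueryComplexity {F : Type u} [Field F] [Fintype F] {m n : ℕ} {α : Type}
    (f : Matrix (Fin m) (Fin n) F → α) (ε : ℝ) : ℕ :=
  sInf (mvQueryCounts f ε)

end

/-! Lower bound, by the polynomial method: after `t` queries every amplitude is a linear combination
of functions of `M` restricted to a subspace of dimension at most `t`, and output probabilities need
dimension at most `2 * t` (`state_apply_mem_span`, `probSet_mem_span`). On `m × k` matrices, `k =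
min m n`, there is a nowhere vanishing weight with sign `(-1) ^ rank` that annihilates all such
functions of dimension below `k` (`rankFunctional_eq_zero`). If `2 * t < k`, it annihilates `P -
1/2`, where `P` is the probability of an even output; but correctness makes every term of the
weighted sum positive.

Upper bound: `n` queries learn the columns one by one. A Fourier transform turns the oracle of `M`
into that of its transpose (`transposer_mvOracle`), so `m` queries suffice as well. -/

noncomputable section

/-! ### The alternating weight and its balance on rank-one pencils. -/

section RankWeight

variable {F : Type u} [Field F] {m k : ℕ}

/-- The absolute value of the weight of the matrices of rank `r`. -/
def rankWeightAbs (q m r : ℕ) : ℝ :=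
  ∏ j ∈ Finset.range r, (q : ℝ) ^ j / ((q : ℝ) ^ m - (q : ℝ) ^ j)

/-- A signed weight on matrices that alternates in sign with the rank and is balanced on every
rank-one pencil. -/
def rankWeight [Fintype F] (M : Matrix (Fin m) (Fin k) F) : ℝ :=
  (-1) ^ M.rank * rankWeightAbs (Fintype.card F) m M.rank

lemma rankWeightAbs_pos {q m r : ℕ} (hq : 1 < q) (hr : r ≤ m) : 0 < rankWeightAbs q m r := by
  have hq' : (1 : ℝ) < q := by exact_mod_cast hq
  refine Finset.prod_pos fun j hj => div_pos (by positivity) (sub_pos.2 ?_)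
  exact pow_lt_pow_right₀ hq' (lt_of_lt_of_le (Finset.mem_range.1 hj) hr)

/-- The factors of the weight are chosen for this recursion: a rank-one pencil that contains rank
`r` and rank `r + 1` has `q ^ r` members of the former and `q ^ m - q ^ r` of the latter. -/
lemma rankWeightAbs_succ {q m r : ℕ} (hq : 1 < q) (hr : r < m) :
    ((q : ℝ) ^ m - (q : ℝ) ^ r) * rankWeightAbs q m (r + 1) = (q : ℝ) ^ r * rankWeightAbs q m r := by
  have hq' : (1 : ℝ) < q := by exact_mod_cast hq
  have : (q : ℝ) ^ m - (q : ℝ) ^ r ≠ 0 := (sub_pos.2 (pow_lt_pow_right₀ hq' hr)).ne'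
  rw [rankWeightAbs, Finset.prod_range_succ, ← rankWeightAbs]
  field_simp

/-- The kernel of the linear form given by a nonzero vector is a hyperplane. -/
lemma finrank_ker_dotProduct {v w : Fin k → F} (hvw : v ⬝ᵥ w = 1) :
    Module.finrank F (LinearMap.ker (dotProductBilin F F v)) + 1 = k := by
  have h := LinearMap.finrank_range_add_finrank_ker (dotProductBilin F F v)
  have hs : Function.Surjective (dotProductBilin F F v) := fun a =>
    ⟨a • w, by simp [hvw]⟩
  rw [LinearMap.range_eq_top.2 hs, finrank_top] at h
  simp at h
  omega

/-- The space splits as `ker v ⊕ F w`. The perturbation vanishes on `ker v` and adds `u` to the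
image of `w`. -/
lemma range_add_vecMulVec (M : Matrix (Fin m) (Fin k) F) (u : Fin m → F) {v w : Fin k → F}
    (hvw : v ⬝ᵥ w = 1) :
    LinearMap.range (M + Matrix.vecMulVec u v).mulVecLin =
      (LinearMap.ker (dotProductBilin F F v)).map M.mulVecLin ⊔ F ∙ (M *ᵥ w + u) := by
  have key (x : Fin k → F) : (M + Matrix.vecMulVec u v) *ᵥ x = M *ᵥ x + (v ⬝ᵥ x) • u := by
    rw [Matrix.add_mulVec, Matrix.vecMulVec_mulVec]; simp
  apply le_antisymm
  · rintro _ ⟨x, rfl⟩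
    rw [Matrix.mulVecLin_apply, key]
    refine Submodule.mem_sup.2 ⟨M *ᵥ (x - (v ⬝ᵥ x) • w), ⟨_, ?_, rfl⟩, (v ⬝ᵥ x) • (M *ᵥ w + u),
      Submodule.smul_mem _ _ (Submodule.mem_span_singleton_self _), ?_⟩
    · simp [hvw]
    · rw [Matrix.mulVec_sub, Matrix.mulVec_smul, smul_add]; abel
  · refine sup_le ?_ ?_
    · rintro _ ⟨x, hx, rfl⟩
      refine ⟨x, ?_⟩
      have hx : v ⬝ᵥ x = 0 := hx
      rw [Matrix.mulVecLin_apply, key, hx, zero_smul, add_zero, Matrix.mulVecLin_apply]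
    · rw [Submodule.span_singleton_le_iff_mem]
      exact ⟨w, by rw [Matrix.mulVecLin_apply, key, hvw, one_smul]⟩

lemma rank_add_vecMulVec (M : Matrix (Fin m) (Fin k) F) (u : Fin m → F) {v w : Fin k → F}
    (hvw : v ⬝ᵥ w = 1) {R : Submodule F (Fin m → F)}
    (hR : R = (LinearMap.ker (dotProductBilin F F v)).map M.mulVecLin) [Decidable (M *ᵥ w + u ∈ R)] :
    (M + Matrix.vecMulVec u v).rank =
      if M *ᵥ w + u ∈ R then Module.finrank F R else Module.finrank F R + 1 := by
  rw [Matrix.rank, range_add_vecMulVec M u hvw, ← hR]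
  split_ifs with h
  · rw [sup_eq_left.2 ((Submodule.span_singleton_le_iff_mem _ _).2 h)]
  · exact Submodule.finrank_sup_span_singleton h

open scoped Classical in
-- As `u` varies, `M w + u` takes each value in `F ^ m` once. The rank is `dim R` if this value lies
-- in `R` and `dim R + 1` otherwise, so the recursion cancels the two contributions.
lemma sum_rankWeight_add_vecMulVec [Fintype F] (hkm : k ≤ m) (M : Matrix (Fin m) (Fin k) F)
    {v : Fin k → F} (hv : v ≠ 0) :
    ∑ u : Fin m → F, rankWeight (M + Matrix.vecMulVec u v) = 0 := by
  obtain ⟨w, hvw⟩ : ∃ w : Fin k → F, v ⬝ᵥ w = 1 := by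
    obtain ⟨i, hi⟩ := Function.ne_iff.1 hv
    exact ⟨Pi.single i (v i)⁻¹, by simpa using mul_inv_cancel₀ hi⟩
  obtain ⟨R, hR⟩ : ∃ R, R = (LinearMap.ker (dotProductBilin F F v)).map M.mulVecLin := ⟨_, rfl⟩
  -- Here `k ≤ m` enters: `dim R ≤ k - 1 < m`, so rank `dim R + 1` does occur in the pencil.
  have hj : Module.finrank F R < m := by
    have h1 := finrank_ker_dotProduct hvw
    have h2 := Submodule.finrank_map_le M.mulVecLin (LinearMap.ker (dotProductBilin F F v))
    rw [← hR] at h2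
    omega
  have hq : 1 < Fintype.card F := Fintype.one_lt_card
  set q := Fintype.card F
  set j := Module.finrank F R
  have hcard : (Finset.univ.filter (· ∈ R)).card = q ^ j := by
    rw [← Fintype.card_subtype]
    exact Module.card_eq_pow_finrank (K := F) (V := R)
  have hcard' : ((Finset.univ.filter (· ∉ R)).card : ℝ) = (q : ℝ) ^ m - (q : ℝ) ^ j := by
    have h := Finset.card_filter_add_card_filter_not (s := (Finset.univ : Finset (Fin m → F)))
      (· ∈ R)
    rw [hcard, Finset.card_univ, Fintype.card_fun, Fintype.card_fin] at h
    rw [eq_sub_iff_add_eq']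
    exact_mod_cast h
  have hsum : ∑ u : Fin m → F, rankWeight (M + Matrix.vecMulVec u v) =
      ∑ c : Fin m → F, if c ∈ R then (-1 : ℝ) ^ j * rankWeightAbs q m j
        else (-1 : ℝ) ^ (j + 1) * rankWeightAbs q m (j + 1) := by
    refine Fintype.sum_equiv (Equiv.addLeft (M *ᵥ w)) _ _ fun u => ?_
    rw [rankWeight, rank_add_vecMulVec M u hvw hR]
    by_cases h : M *ᵥ w + u ∈ R
    · rw [if_pos h]
      exact (if_pos h).symm
    · rw [if_neg h]
      exact (if_neg h).symm
  rw [hsum, Finset.sum_ite, Finset.sum_const, Finset.sum_const, nsmul_eq_mul, nsmul_eq_mul, hcard,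
    hcard']
  have h := rankWeightAbs_succ hq hj
  push_cast
  linear_combination (-(-1 : ℝ) ^ j) * h

end RankWeight

/-! ### The weighted sum annihilates functions of low-dimensional actions. -/

section Span

variable {F : Type u} [Field F] {m n k : ℕ}

/-- Functions of a matrix that depend only on its action on some subspace of dimension at most
`d`. -/
def actionJuntas (F : Type u) [Field F] (m n d : ℕ) : Set (Matrix (Fin m) (Fin n) F → ℂ) :=
  {f | ∃ X : Submodule F (Fin n → F), Module.finrank F X ≤ d ∧
    ∀ M M' : Matrix (Fin m) (Fin n) F, (∀ x ∈ X, M *ᵥ x = M' *ᵥ x) → f M = f M'}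

/-- The matrix of the projection to the first `k` coordinates. -/
def projFirst (F : Type u) [Field F] (h : k ≤ n) : Matrix (Fin k) (Fin n) F :=
  (1 : Matrix (Fin n) (Fin n) F).submatrix (Fin.castLE h) id

lemma projFirst_mul_transpose (h : k ≤ n) : projFirst F h * (projFirst F h)ᵀ = 1 := by
  ext i j
  simp [projFirst, Matrix.mul_apply, Matrix.one_apply]

lemma rank_mul_projFirst (h : k ≤ n) (M : Matrix (Fin m) (Fin k) F) :
    (M * projFirst F h).rank = M.rank := by
  apply le_antisymm (Matrix.rank_mul_le_left _ _)
  conv_lhs => rw [← Matrix.mul_one M, ← projFirst_mul_transpose h, ← Matrix.mul_assoc]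
  exact Matrix.rank_mul_le_left _ _

variable [Fintype F]

/-- The weighted sum of a function over the matrices supported on the first `k` columns. -/
def rankFunctional (F : Type u) [Field F] [Fintype F] (m : ℕ) (h : k ≤ n) :
    (Matrix (Fin m) (Fin n) F → ℂ) →ₗ[ℂ] ℂ :=
  ∑ M : Matrix (Fin m) (Fin k) F,
    ((rankWeight M : ℝ) : ℂ) • LinearMap.proj (M * projFirst F h)

lemma rankFunctional_apply (h : k ≤ n) (f : Matrix (Fin m) (Fin n) F → ℂ) :
    rankFunctional F m h f =
      ∑ M : Matrix (Fin m) (Fin k) F, ((rankWeight M : ℝ) : ℂ) * f (M * projFirst F h) := by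
  simp only [rankFunctional, LinearMap.sum_apply, LinearMap.smul_apply, LinearMap.proj_apply,
    smul_eq_mul]

/-- The projection of `X` to `F ^ k` is a proper subspace, so some `v ≠ 0` is orthogonal to it. Then
`f` is constant on every pencil in the direction `v`, and averaging over `u` reduces the claim to
the balance of the weight. -/
lemma rankFunctional_eq_zero_of_mem_actionJuntas (h : k ≤ n) (hkm : k ≤ m) {d : ℕ} (hd : d < k)
    {f : Matrix (Fin m) (Fin n) F → ℂ} (hf : f ∈ actionJuntas F m n d) :
    rankFunctional F m h f = 0 := by
  obtain ⟨X, hX, hf⟩ := hf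
  obtain ⟨v, hv, hvX⟩ : ∃ v : Fin k → F, v ≠ 0 ∧ ∀ x ∈ X, v ⬝ᵥ (projFirst F h *ᵥ x) = 0 := by
    have hlt : X.map (projFirst F h).mulVecLin < ⊤ := by
      refine Submodule.lt_top_of_finrank_lt_finrank ?_
      have := Submodule.finrank_map_le (projFirst F h).mulVecLin X
      rw [Module.finrank_fin_fun]
      omega
    obtain ⟨φ, hφ, hle⟩ := Submodule.exists_le_ker_of_lt_top _ hlt
    obtain ⟨v, rfl⟩ := (dotProductEquiv F (Fin k)).surjective φ
    exact ⟨v, by rintro rfl; simp at hφ, fun x hx => hle ⟨x, hx, rfl⟩⟩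
  have hinv (u : Fin m → F) (M : Matrix (Fin m) (Fin k) F) :
      f ((M + Matrix.vecMulVec u v) * projFirst F h) = f (M * projFirst F h) := by
    refine hf _ _ fun x hx => ?_
    rw [← Matrix.mulVec_mulVec, ← Matrix.mulVec_mulVec, Matrix.add_mulVec,
      Matrix.vecMulVec_mulVec, hvX x hx]
    simp
  have hshift (u : Fin m → F) : rankFunctional F m h f =
      ∑ M : Matrix (Fin m) (Fin k) F,
        ((rankWeight (M + Matrix.vecMulVec u v) : ℝ) : ℂ) * f (M * projFirst F h) := by
    rw [rankFunctional_apply, ← Equiv.sum_comp (Equiv.addRight (Matrix.vecMulVec u v))]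
    simp only [Equiv.coe_addRight, hinv]
  have hsum : ∑ _u : Fin m → F, rankFunctional F m h f = 0 := by
    rw [Finset.sum_congr rfl fun u _ => hshift u, Finset.sum_comm]
    refine Finset.sum_eq_zero fun M _ => ?_
    rw [← Finset.sum_mul, ← Complex.ofReal_sum, sum_rankWeight_add_vecMulVec hkm M hv]
    simp
  rw [Finset.sum_const, Finset.card_univ] at hsum
  exact (smul_eq_zero.1 hsum).resolve_left Fintype.card_ne_zero

lemma rankFunctional_eq_zero (h : k ≤ n) (hkm : k ≤ m) {d : ℕ} (hd : d < k)
    {f : Matrix (Fin m) (Fin n) F → ℂ} (hf : f ∈ Submodule.span ℂ (actionJuntas F m n d)) :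
    rankFunctional F m h f = 0 :=
  (Submodule.span_le (p := LinearMap.ker (rankFunctional F m h))).2
    (fun _ hg => rankFunctional_eq_zero_of_mem_actionJuntas h hkm hd hg) hf

end Span

/-! ### Calculus of action juntas, with dimension in the role of degree. -/

section Juntas

variable {F : Type u} [Field F] {m n : ℕ}

lemma const_mem_actionJuntas (d : ℕ) (c : ℂ) : (fun _ => c) ∈ actionJuntas F m n d :=
  ⟨⊥, by simp, fun _ _ _ => rfl⟩

lemma mul_mem_actionJuntas {d e : ℕ} {f g : Matrix (Fin m) (Fin n) F → ℂ}
    (hf : f ∈ actionJuntas F m n d) (hg : g ∈ actionJuntas F m n e) :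
    f * g ∈ actionJuntas F m n (d + e) := by
  obtain ⟨X, hX, hf⟩ := hf
  obtain ⟨Y, hY, hg⟩ := hg
  refine ⟨X ⊔ Y, (Submodule.finrank_add_le_finrank_add_finrank X Y).trans (add_le_add hX hY),
    fun M M' h => ?_⟩
  rw [Pi.mul_apply, Pi.mul_apply, hf M M' fun x hx => h x (Submodule.mem_sup_left hx),
    hg M M' fun x hx => h x (Submodule.mem_sup_right hx)]

lemma star_mem_actionJuntas {d : ℕ} {f : Matrix (Fin m) (Fin n) F → ℂ}
    (hf : f ∈ actionJuntas F m n d) : star f ∈ actionJuntas F m n d := by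
  obtain ⟨X, hX, hf⟩ := hf
  exact ⟨X, hX, fun M M' h => congrArg star (hf M M' h)⟩

lemma mul_mem_span_actionJuntas {d e : ℕ} {f g : Matrix (Fin m) (Fin n) F → ℂ}
    (hf : f ∈ Submodule.span ℂ (actionJuntas F m n d))
    (hg : g ∈ Submodule.span ℂ (actionJuntas F m n e)) :
    f * g ∈ Submodule.span ℂ (actionJuntas F m n (d + e)) := by
  have h := Submodule.mul_mem_mul hf hg
  rw [Submodule.span_mul_span] at h
  refine Submodule.span_mono ?_ h
  rintro _ ⟨f, hf, g, hg, rfl⟩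
  exact mul_mem_actionJuntas hf hg

lemma star_mem_span_actionJuntas {d : ℕ} {f : Matrix (Fin m) (Fin n) F → ℂ}
    (hf : f ∈ Submodule.span ℂ (actionJuntas F m n d)) :
    star f ∈ Submodule.span ℂ (actionJuntas F m n d) := by
  induction hf using Submodule.span_induction with
  | mem f hf => exact Submodule.subset_span (star_mem_actionJuntas hf)
  | zero => simp
  | add f g _ _ hf hg => rw [star_add]; exact add_mem hf hg
  | smul c f _ hf => rw [star_smul]; exact Submodule.smul_mem _ _ hf

open scoped Classical in
lemma indicator_mem_actionJuntas (x : Fin n → F) (z : Fin m → F) :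
    (fun M : Matrix (Fin m) (Fin n) F => if M *ᵥ x = z then (1 : ℂ) else 0) ∈
      actionJuntas F m n 1 :=
  ⟨F ∙ x, (finrank_span_le_card {x}).trans (by simp), fun M M' h => by
    simp only [h x (Submodule.mem_span_singleton_self x)]⟩

end Juntas

/-! ### The polynomial method for matrix-vector queries. -/

section LowerBound

variable {F : Type u} [Field F] [Fintype F] {m n : ℕ} {α : Type}

lemma linearMap_apply_eq_sum {ι κ : Type*} [Fintype ι] [DecidableEq ι] [Fintype κ]
    (T : EuclideanSpace ℂ ι →ₗ[ℂ] EuclideanSpace ℂ κ) (v : EuclideanSpace ℂ ι) (b : κ) :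
    T v b = ∑ i, T (EuclideanSpace.single i 1) b * v i := by
  conv_lhs => rw [← (EuclideanSpace.basisFun ι ℂ).sum_repr v]
  simp [mul_comm]

lemma mvOracle_apply (W : Type u) [Fintype W] (M : Matrix (Fin m) (Fin n) F)
    (v : MVSpace F m n W) (b : MVBasis F m n W) :
    mvOracle W M v b = v (b.1, b.2.1 - M *ᵥ b.1, b.2.2) := rfl

namespace MVAlgorithm

/-- The amplitude at `(x, y, w)` after a query is the sum over `z` of the old amplitude at `(x, z,
w)` times the indicator of `M x = y - z`, a junta of dimension one. Gates only take linear
combinations with coefficients independent of `M`. -/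
lemma state_apply_mem_span (A : MVAlgorithm F m n α) (t : ℕ) (b : MVBasis F m n A.W) :
    (fun M => A.state M t b) ∈ Submodule.span ℂ (actionJuntas F m n t) := by
  classical
  induction t generalizing b with
  | zero => exact Submodule.subset_span (const_mem_actionJuntas 0 (A.init b))
  | succ t ih =>
    have horacle (b : MVBasis F m n A.W) : (fun M => mvOracle A.W M (A.state M t) b) ∈
        Submodule.span ℂ (actionJuntas F m n (t + 1)) := by
      have : (fun M => mvOracle A.W M (A.state M t) b) = ∑ z : Fin m → F,
          (fun M => A.state M t (b.1, z, b.2.2)) *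
            (fun M => if M *ᵥ b.1 = b.2.1 - z then (1 : ℂ) else 0) := by
        funext M
        simp only [mvOracle_apply, Finset.sum_apply, Pi.mul_apply, mul_ite, mul_one, mul_zero]
        rw [Finset.sum_eq_single (b.2.1 - M *ᵥ b.1)]
        · simp
        · intro z _ hz
          rw [if_neg]
          rintro h
          exact hz (by rw [h]; simp)
        · simp
      rw [this]
      exact sum_mem fun z _ => mul_mem_span_actionJuntas (ih _)
        (Submodule.subset_span (indicator_mem_actionJuntas _ _))
    have : (fun M => A.state M (t + 1) b) = ∑ i : MVBasis F m n A.W,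
        A.gate t (EuclideanSpace.single i 1) b • fun M => mvOracle A.W M (A.state M t) i := by
      funext M
      simp only [state, Finset.sum_apply, Pi.smul_apply, smul_eq_mul]
      exact linearMap_apply_eq_sum (A.gate t).toLinearEquiv.toLinearMap _ b
    rw [this]
    exact sum_mem fun i _ => Submodule.smul_mem _ _ (horacle i)

lemma norm_state (A : MVAlgorithm F m n α) (M : Matrix (Fin m) (Fin n) F) (t : ℕ) :
    ‖A.state M t‖ = 1 := by
  induction t with
  | zero => exact A.norm_init
  | succ t ih => simpa [state] using ih

open scoped Classical in
/-- The probability that the output lies in `S`. -/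
def probSet (A : MVAlgorithm F m n α) (S : Set α) (M : Matrix (Fin m) (Fin n) F) : ℝ :=
  ∑ b : MVBasis F m n A.W, if A.output b ∈ S then ‖A.state M A.queries b‖ ^ 2 else 0

lemma probSet_mem_span (A : MVAlgorithm F m n α) (S : Set α) :
    (fun M => (A.probSet S M : ℂ)) ∈ Submodule.span ℂ (actionJuntas F m n (2 * A.queries)) := by
  classical
  have : (fun M => (A.probSet S M : ℂ)) = ∑ b : MVBasis F m n A.W,
      if A.output b ∈ S then star (fun M => A.state M A.queries b) * fun M => A.state M A.queries b
      else 0 := by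
    funext M
    rw [Finset.sum_apply, probSet, Complex.ofReal_sum]
    refine Finset.sum_congr rfl fun b _ => ?_
    split_ifs
    · simp [← Complex.conj_mul']
    · simp
  rw [this, two_mul]
  refine sum_mem fun b _ => ?_
  split_ifs
  · exact mul_mem_span_actionJuntas (star_mem_span_actionJuntas (A.state_apply_mem_span _ b))
      (A.state_apply_mem_span _ b)
  · exact zero_mem _

lemma prob_le_probSet (A : MVAlgorithm F m n α) {S : Set α} {a : α} (ha : a ∈ S)
    (M : Matrix (Fin m) (Fin n) F) : A.prob M a ≤ A.probSet S M := by
  refine Finset.sum_le_sum fun b _ => ?_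
  by_cases h : A.output b = a
  · simp [h, ha]
  · rw [if_neg h]
    split_ifs <;> positivity

lemma probSet_add_compl (A : MVAlgorithm F m n α) (S : Set α) (M : Matrix (Fin m) (Fin n) F) :
    A.probSet S M + A.probSet Sᶜ M = 1 := by
  classical
  have h := EuclideanSpace.norm_sq_eq (A.state M A.queries)
  rw [A.norm_state, one_pow] at h
  rw [h, probSet, probSet, ← Finset.sum_add_distrib]
  refine Finset.sum_congr rfl fun b _ => ?_
  by_cases hb : A.output b ∈ S <;> simp [hb]

/-- Computing the rank with error below one half takes at least `min m n / 2` queries. -/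
theorem min_le_two_mul_queries (A : MVAlgorithm F m n ℕ) {ε : ℝ} (hε : ε < 1 / 2)
    (hA : A.Computes (fun M => M.rank) ε) : min m n ≤ 2 * A.queries := by
  classical
  by_contra! hlt
  have hkn : min m n ≤ n := min_le_right _ _
  have hkm : min m n ≤ m := min_le_left _ _
  set P : Matrix (Fin m) (Fin n) F → ℝ := A.probSet {r | Even r}
  have hzero : rankFunctional F m hkn
      ((fun M => (P M : ℂ)) - fun _ => ((1 / 2 : ℝ) : ℂ)) = 0 :=
    rankFunctional_eq_zero hkn hkm hlt
      (sub_mem (A.probSet_mem_span _) (Submodule.subset_span (const_mem_actionJuntas _ _)))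
  rw [rankFunctional_apply] at hzero
  have hreal : ∑ M : Matrix (Fin m) (Fin (min m n)) F,
      rankWeight M * (P (M * projFirst F hkn) - 1 / 2) = 0 := by
    simp only [Pi.sub_apply, ← Complex.ofReal_sub, ← Complex.ofReal_mul] at hzero
    rw [← Complex.ofReal_sum] at hzero
    exact Complex.ofReal_eq_zero.1 hzero
  -- The rank parity fixes both the sign of the weight and, since `ε < 1 / 2`, the side of `1 / 2`
  -- on which `P` lies; the two signs agree.
  refine (Finset.sum_pos (fun M _ => ?_) Finset.univ_nonempty).ne' hreal
  have habs : 0 < rankWeightAbs (Fintype.card F) m M.rank :=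
    rankWeightAbs_pos Fintype.one_lt_card (M.rank_le_height)
  have hM : 1 - ε ≤ A.prob (M * projFirst F hkn) M.rank := by
    simpa only [rank_mul_projFirst] using hA (M * projFirst F hkn)
  rcases Nat.even_or_odd M.rank with hr | hr
  · rw [rankWeight, hr.neg_one_pow, one_mul]
    have := A.prob_le_probSet (S := {r | Even r}) hr (M * projFirst F hkn)
    exact mul_pos habs (by simp only [P]; linarith)
  · rw [rankWeight, hr.neg_one_pow]
    have h1 := A.prob_le_probSet (S := {r | Even r}ᶜ) (Nat.not_even_iff_odd.2 hr)
      (M * projFirst F hkn)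
    have h2 := A.probSet_add_compl {r | Even r} (M * projFirst F hkn)
    have : P (M * projFirst F hkn) - 1 / 2 < 0 := by simp only [P]; linarith
    nlinarith [mul_pos habs (neg_pos.2 this)]

end MVAlgorithm

end LowerBound

/-! ### An exact algorithm with `n` queries. -/

section ColumnLearning

variable {F : Type u} [Field F] {m n : ℕ}

/-- The standard basis vector with index `t`, and the zero vector if `n ≤ t`. -/
def queryVec (F : Type u) [Field F] (n t : ℕ) : Fin n → F := fun i => if (i : ℕ) = t then 1 else 0

lemma mulVec_queryVec (M : Matrix (Fin m) (Fin n) F) (t : Fin n) :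
    M *ᵥ queryVec F n t = fun i => M i t := by
  ext i
  simp [queryVec, Matrix.mulVec, dotProduct, ← Fin.ext_iff]

/-- Exchange the answer register with the cell `t` of the workspace, and turn the query for
column `t` into the query for the next column. -/
def storeColumn (F : Type u) [Field F] (m : ℕ) (t : Fin n) :
    MVBasis F m n (Fin n → Fin m → F) ≃ MVBasis F m n (Fin n → Fin m → F) where
  toFun b := (b.1 + (queryVec F n (t + 1) - queryVec F n t), b.2.2 t,
    Function.update b.2.2 t b.2.1)
  invFun b := (b.1 - (queryVec F n (t + 1) - queryVec F n t), b.2.2 t,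
    Function.update b.2.2 t b.2.1)
  left_inv b := by simp
  right_inv b := by simp

/-- The basis label reached after learning the first `t` columns. -/
def learnedLabel (M : Matrix (Fin m) (Fin n) F) (t : ℕ) : MVBasis F m n (Fin n → Fin m → F) :=
  (queryVec F n t, 0, fun j i => if (j : ℕ) < t then M i j else 0)

/-- Cell `t` is still zero when it is exchanged with column `t`, so the exchange also resets the
answer register. -/
lemma storeColumn_learnedLabel (M : Matrix (Fin m) (Fin n) F) (t : Fin n) :
    storeColumn F m t (mvPerm _ M (learnedLabel M t)) = learnedLabel M (t + 1) := by
  simp only [storeColumn, mvPerm, learnedLabel, Equiv.coe_fn_mk, mulVec_queryVec]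
  refine Prod.ext (by simp) (Prod.ext (by ext; simp) ?_)
  funext j i
  by_cases h : j = t
  · subst h
    simp
  · have h' : (j : ℕ) ≠ t := fun e => h (Fin.ext e)
    have : (j : ℕ) < t + 1 ↔ (j : ℕ) < t := by omega
    simp [h, this]

variable [Fintype F] {α : Type}

open scoped Classical in
/-- The basis state reached after learning the first `t` columns. -/
def learnedState (M : Matrix (Fin m) (Fin n) F) (t : ℕ) : MVSpace F m n (Fin n → Fin m → F) :=
  EuclideanSpace.single (learnedLabel M t) 1

lemma storeColumn_learnedState (M : Matrix (Fin m) (Fin n) F) (t : Fin n) :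
    LinearIsometryEquiv.piLpCongrLeft 2 ℂ ℂ (storeColumn F m t)
      (mvOracle _ M (learnedState M t)) = learnedState M (t + 1) := by
  classical
  rw [learnedState, mvOracle, EuclideanSpace.piLpCongrLeft_single,
    EuclideanSpace.piLpCongrLeft_single, storeColumn_learnedLabel, learnedState]

/-- The algorithm that computes `f` by learning the columns one by one. -/
def columnLearner (f : Matrix (Fin m) (Fin n) F → α) : MVAlgorithm F m n α where
  W := Fin n → Fin m → F
  queries := n
  init := learnedState 0 0
  norm_init := by simp [learnedState]
  gate k := if h : k < n then LinearIsometryEquiv.piLpCongrLeft 2 ℂ ℂ (storeColumn F m ⟨k, h⟩)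
    else LinearIsometryEquiv.refl ℂ _
  output b := f (Matrix.of fun i j => b.2.2 j i)

lemma columnLearner_state (f : Matrix (Fin m) (Fin n) F → α) (M : Matrix (Fin m) (Fin n) F)
    {t : ℕ} (ht : t ≤ n) : (columnLearner f).state M t = learnedState M t := by
  induction t with
  | zero =>
    change learnedState 0 0 = learnedState M 0
    simp [learnedState, learnedLabel]
  | succ t ih =>
    have hgate : (columnLearner f).gate t =
        LinearIsometryEquiv.piLpCongrLeft 2 ℂ ℂ (storeColumn F m ⟨t, ht⟩) := dif_pos ht
    rw [MVAlgorithm.state, ih (by omega), hgate]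
    exact storeColumn_learnedState M ⟨t, ht⟩

lemma columnLearner_computes (f : Matrix (Fin m) (Fin n) F → α) :
    (columnLearner f).Computes f 0 := by
  classical
  intro M
  have hs := columnLearner_state f M le_rfl
  have hout : (columnLearner f).output (learnedLabel M n) = f M := by
    refine congrArg f ?_
    ext i j
    simp [learnedLabel]
  rw [MVAlgorithm.prob, sub_zero]
  refine le_trans (le_of_eq ?_) (Finset.single_le_sum
    (fun b _ => by split_ifs <;> positivity) (Finset.mem_univ (learnedLabel M n)))
  rw [if_pos hout]
  change 1 = ‖(columnLearner f).state M n _‖ ^ 2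
  rw [hs]
  simp [learnedState]

end ColumnLearning

/-! ### Phase kickback and the oracle of the transpose. -/

section Transposition

variable {F : Type u} [Field F] [Fintype F] {m n : ℕ}

/-- A nontrivial additive character of a finite field with complex values. -/
def complexChar (F : Type u) [Field F] [Fintype F] : AddChar F ℂ :=
  AddChar.FiniteField.primitiveChar_to_Complex F

open scoped Classical in
lemma sum_complexChar_dotProduct (a : Fin m → F) :
    ∑ y : Fin m → F, complexChar F (a ⬝ᵥ y) = if a = 0 then (Fintype.card F : ℂ) ^ m else 0 := by
  split_ifs with h
  · simp [h]
  · obtain ⟨i, hi⟩ := Function.ne_iff.1 h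
    obtain ⟨x, hx⟩ := AddChar.ne_one_iff.1
      (AddChar.FiniteField.primitiveChar_to_Complex_isPrimitive (F := F) hi)
    have hne : (complexChar F).compAddMonoidHom (dotProductBilin F F a).toAddMonoidHom ≠ 1 := by
      refine AddChar.ne_one_iff.2 ⟨Pi.single i x, ?_⟩
      simpa [complexChar] using hx
    exact AddChar.sum_eq_zero_of_ne_one hne

open scoped Classical in
/-- The state `|x⟩ |χ_b⟩ |w⟩` for the label `(x, b, w)`, with `χ_b` a character state. -/
def fourierVec (W : Type u) [Fintype W] (i : MVBasis F m n W) : MVSpace F m n W :=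
  WithLp.toLp 2 fun p => if p.1 = i.1 ∧ p.2.2 = i.2.2 then
    (√((Fintype.card F : ℝ) ^ m) : ℂ)⁻¹ * complexChar F (-(i.2.1 ⬝ᵥ p.2.1)) else 0

lemma orthonormal_fourierVec (W : Type u) [Fintype W] :
    Orthonormal ℂ (fourierVec W : MVBasis F m n W → MVSpace F m n W) := by
  classical
  rw [orthonormal_iff_ite]
  rintro ⟨x, b, w⟩ ⟨x', b', w'⟩
  rw [PiLp.inner_apply]
  by_cases hxw : x = x' ∧ w = w'
  · obtain ⟨rfl, rfl⟩ := hxw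
    have hq : (0 : ℝ) ≤ (Fintype.card F : ℝ) ^ m := by positivity
    have hterm (y : Fin m → F) : (starRingEnd ℂ) ((√((Fintype.card F : ℝ) ^ m) : ℂ)⁻¹ *
        complexChar F (-(b ⬝ᵥ y))) * ((√((Fintype.card F : ℝ) ^ m) : ℂ)⁻¹ *
        complexChar F (-(b' ⬝ᵥ y))) =
        ((Fintype.card F : ℂ) ^ m)⁻¹ * complexChar F ((b - b') ⬝ᵥ y) := by
      have h1 : ((√((Fintype.card F : ℝ) ^ m) : ℂ)⁻¹) * (√((Fintype.card F : ℝ) ^ m) : ℂ)⁻¹ =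
          ((Fintype.card F : ℂ) ^ m)⁻¹ := by
        rw [← mul_inv, ← Complex.ofReal_mul, Real.mul_self_sqrt hq]
        push_cast
        rfl
      rw [sub_dotProduct, sub_eq_add_neg, AddChar.map_add_eq_mul, map_mul, map_inv₀,
        Complex.conj_ofReal, ← AddChar.map_neg_eq_conj, neg_neg, ← h1]
      ring
    have hsum : ∑ p : MVBasis F m n W, inner ℂ (fourierVec W (x, b, w) p)
        (fourierVec W (x, b', w) p) =
        ∑ y : Fin m → F, ((Fintype.card F : ℂ) ^ m)⁻¹ * complexChar F ((b - b') ⬝ᵥ y) := by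
      rw [Fintype.sum_prod_type, Finset.sum_eq_single x, Fintype.sum_prod_type]
      · refine Finset.sum_congr rfl fun y _ => ?_
        rw [Finset.sum_eq_single w, ← hterm]
        · simp [fourierVec, mul_comm]
        · intro w' _ hw
          simp [fourierVec, hw]
        · simp
      · intro x' _ hx
        simp [fourierVec, hx]
      · simp
    rw [hsum, ← Finset.mul_sum, sum_complexChar_dotProduct]
    by_cases hb : b = b'
    · simp [hb]
    · simp [hb, sub_eq_zero]
  · rw [if_neg (fun h => hxw (by simp_all))]
    refine Finset.sum_eq_zero fun p _ => ?_
    by_cases h1 : p.1 = x ∧ p.2.2 = w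
    · have h2 : ¬ (p.1 = x' ∧ p.2.2 = w') := fun h2 =>
        hxw ⟨h1.1.symm.trans h2.1, h1.2.symm.trans h2.2⟩
      simp [fourierVec, h2]
    · simp [fourierVec, h1]

/-- The orthonormal basis of the states `|x⟩ |χ_b⟩ |w⟩`. -/
def mvFourierBasis (F : Type u) [Field F] [Fintype F] (m n : ℕ) (W : Type u) [Fintype W] :
    OrthonormalBasis (MVBasis F m n W) ℂ (MVSpace F m n W) :=
  OrthonormalBasis.mk (orthonormal_fourierVec W) (by
    rw [(orthonormal_fourierVec W).linearIndependent.span_eq_top_of_card_eq_finrank'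
      (by classical simp)])

lemma mvFourierBasis_apply (W : Type u) [Fintype W] (i : MVBasis F m n W) :
    mvFourierBasis F m n W i = fourierVec W i := by
  simp [mvFourierBasis]

/-- Translating a character state only multiplies it by a phase. -/
lemma mvOracle_fourierBasis (W : Type u) [Fintype W] (M : Matrix (Fin m) (Fin n) F)
    (i : MVBasis F m n W) : mvOracle W M (mvFourierBasis F m n W i) =
      complexChar F (i.2.1 ⬝ᵥ M *ᵥ i.1) • mvFourierBasis F m n W i := by
  ext p
  rw [mvOracle_apply, mvFourierBasis_apply]
  simp only [fourierVec, PiLp.smul_apply, smul_eq_mul, mul_ite, mul_zero]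
  split_ifs with h
  swap
  · rfl
  rw [h.1, dotProduct_sub, neg_sub, sub_eq_add_neg, AddChar.map_add_eq_mul]
  ring

/-- Exchange the query and the answer registers. -/
def swapRegisters (F : Type u) (m n : ℕ) (W : Type u) : MVBasis F m n W ≃ MVBasis F n m W where
  toFun b := (b.2.1, b.1, b.2.2)
  invFun b := (b.2.1, b.1, b.2.2)
  left_inv _ := rfl
  right_inv _ := rfl

/-- The unitary operator that conjugates the oracle of a matrix to the oracle of its
transpose. -/
def transposer (F : Type u) [Field F] [Fintype F] (m n : ℕ) (W : Type u) [Fintype W] :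
    MVSpace F m n W ≃ₗᵢ[ℂ] MVSpace F n m W :=
  (mvFourierBasis F m n W).equiv (mvFourierBasis F n m W) (swapRegisters F m n W)

/-- Both oracles are diagonal in their Fourier bases, and the phases match because `b ⬝ᵥ M x = x ⬝ᵥ
Mᵀ b`. -/
lemma transposer_mvOracle (W : Type u) [Fintype W] (M : Matrix (Fin m) (Fin n) F)
    (v : MVSpace F m n W) :
    transposer F m n W (mvOracle W M v) = mvOracle W Mᵀ (transposer F m n W v) := by
  have h : (transposer F m n W).toLinearEquiv.toLinearMap ∘ₗ
      (mvOracle W M).toLinearEquiv.toLinearMap = (mvOracle W Mᵀ).toLinearEquiv.toLinearMap ∘ₗ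
      (transposer F m n W).toLinearEquiv.toLinearMap := by
    refine (mvFourierBasis F m n W).toBasis.ext fun i => ?_
    have ht : transposer F m n W (mvFourierBasis F m n W i) =
        mvFourierBasis F n m W (swapRegisters F m n W i) := OrthonormalBasis.equiv_apply_basis ..
    change transposer F m n W (mvOracle W M ((mvFourierBasis F m n W).toBasis i)) =
      mvOracle W Mᵀ (transposer F m n W ((mvFourierBasis F m n W).toBasis i))
    rw [OrthonormalBasis.coe_toBasis, mvOracle_fourierBasis, map_smul, ht, mvOracle_fourierBasis]
    congr 2
    change _ = i.1 ⬝ᵥ Mᵀ *ᵥ i.2.1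
    rw [Matrix.mulVec_transpose, Matrix.dotProduct_mulVec, dotProduct_comm]
  exact LinearMap.congr_fun h v

namespace MVAlgorithm

variable {α : Type}

/-- An algorithm on `n × m` matrices, run on the transpose of an `m × n` matrix. -/
def onTranspose (A : MVAlgorithm F n m α) : MVAlgorithm F m n α where
  W := A.W
  queries := A.queries
  init := (transposer F m n A.W).symm A.init
  norm_init := by rw [LinearIsometryEquiv.norm_map, A.norm_init]
  -- After the last query the change of basis is not undone: a mere relabelling of registers keeps
  -- the outcome distribution of `A`. This correction needs a last gate, hence at least one query.
  gate k := ((transposer F m n A.W).trans (A.gate k)).trans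
    (if k + 1 = A.queries then LinearIsometryEquiv.piLpCongrLeft 2 ℂ ℂ (swapRegisters F n m A.W)
    else (transposer F m n A.W).symm)
  output b := A.output (swapRegisters F m n A.W b)

lemma onTranspose_state (A : MVAlgorithm F n m α) (M : Matrix (Fin m) (Fin n) F) {t : ℕ}
    (ht : t < A.queries) :
    A.onTranspose.state M t = (transposer F m n A.W).symm (A.state Mᵀ t) := by
  induction t with
  | zero => rfl
  | succ t ih =>
    rw [state, state, ih (by omega)]
    have hgate : A.onTranspose.gate t = ((transposer F m n A.W).trans (A.gate t)).trans
        (transposer F m n A.W).symm :=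
      congrArg (LinearIsometryEquiv.trans _) (if_neg ht.ne)
    rw [hgate]
    change (transposer F m n A.W).symm (A.gate t (transposer F m n A.W (mvOracle A.W M
      ((transposer F m n A.W).symm (A.state Mᵀ t))))) = _
    rw [transposer_mvOracle, LinearIsometryEquiv.apply_symm_apply]

lemma onTranspose_final (A : MVAlgorithm F n m α) (M : Matrix (Fin m) (Fin n) F)
    (hA : 0 < A.queries) (b : MVBasis F m n A.W) :
    A.onTranspose.state M A.queries b = A.state Mᵀ A.queries (swapRegisters F m n A.W b) := by
  obtain ⟨t, ht⟩ : ∃ t, A.queries = t + 1 := ⟨A.queries - 1, by omega⟩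
  rw [ht, state, state, onTranspose_state A M (by omega)]
  have hgate : A.onTranspose.gate t = ((transposer F m n A.W).trans (A.gate t)).trans
      (LinearIsometryEquiv.piLpCongrLeft 2 ℂ ℂ (swapRegisters F n m A.W)) :=
    congrArg (LinearIsometryEquiv.trans _) (if_pos ht.symm)
  rw [hgate]
  change (A.gate t (transposer F m n A.W (mvOracle A.W M
    ((transposer F m n A.W).symm (A.state Mᵀ t))))) (swapRegisters F m n A.W b) = _
  rw [transposer_mvOracle, LinearIsometryEquiv.apply_symm_apply]

lemma onTranspose_prob (A : MVAlgorithm F n m α) (hA : 0 < A.queries)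
    (M : Matrix (Fin m) (Fin n) F) (a : α) : A.onTranspose.prob M a = A.prob Mᵀ a := by
  classical
  rw [prob, prob, ← Equiv.sum_comp (swapRegisters F m n A.W)]
  refine Finset.sum_congr rfl fun b _ => ?_
  exact congrArg (fun z : ℂ => if A.output (swapRegisters F m n A.W b) = a then ‖z‖ ^ 2 else 0)
    (onTranspose_final A M hA b)

end MVAlgorithm

end Transposition

/-! ### The upper bound for the rank. -/

section Rank

variable {F : Type u} [Field F] [Fintype F] {m n : ℕ}

lemma MVAlgorithm.Computes.mono {α : Type} {A : MVAlgorithm F m n α}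
    {f : Matrix (Fin m) (Fin n) F → α} {δ ε : ℝ} (hA : A.Computes f δ) (h : δ ≤ ε) :
    A.Computes f ε :=
  fun M => (sub_le_sub_left h 1).trans (hA M)

/-- The rank can be computed without error by `min m n` queries. -/
theorem min_mem_mvQueryCounts_rank (hm : 1 ≤ m) :
    min m n ∈ mvQueryCounts (fun M : Matrix (Fin m) (Fin n) F => M.rank) 0 := by
  rcases le_total n m with h | h
  · rw [min_eq_right h]
    exact ⟨columnLearner _, rfl, columnLearner_computes _⟩
  · rw [min_eq_left h]
    refine ⟨(columnLearner fun M : Matrix (Fin n) (Fin m) F => M.rank).onTranspose, rfl,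
      fun M => ?_⟩
    rw [MVAlgorithm.onTranspose_prob (columnLearner _) hm]
    simpa only [Matrix.rank_transpose] using
      columnLearner_computes (fun M : Matrix (Fin n) (Fin m) F => M.rank) Mᵀ

end Rank

end

theorem mainTheorem8 (ε : ℝ) (hε₀ : 0 ≤ ε) (hε : ε < 1 / 2) :
    ∃ c C : ℝ, 0 < c ∧ 0 < C ∧
      ∀ (F : Type*) [Field F] [Fintype F] (m n : ℕ), 1 ≤ m → 1 ≤ n →
        (mvQueryCounts (fun M : Matrix (Fin m) (Fin n) F => M.rank) ε).Nonempty ∧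
        c * (min m n : ℕ) ≤
          (mvQueryComplexity (fun M : Matrix (Fin m) (Fin n) F => M.rank) ε : ℝ) ∧
        (mvQueryComplexity (fun M : Matrix (Fin m) (Fin n) F => M.rank) ε : ℝ) ≤
          C * (min m n : ℕ) := by
  -- The factor `1 / 2` reflects the squaring of amplitudes; the `1` comes from the exact algorithm.
  refine ⟨1 / 2, 1, by norm_num, by norm_num, fun F _ _ m n hm _ => ?_⟩
  have hmem : min m n ∈ mvQueryCounts (fun M : Matrix (Fin m) (Fin n) F => M.rank) ε := by
    obtain ⟨A, hA, hcomp⟩ := min_mem_mvQueryCounts_rank (F := F) (n := n) hm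
    exact ⟨A, hA, hcomp.mono hε₀⟩
  refine ⟨⟨_, hmem⟩, ?_, ?_⟩
  · obtain ⟨A, hA, hcomp⟩ := Nat.sInf_mem ⟨_, hmem⟩
    have h : ((min m n : ℕ) : ℝ) ≤ 2 * (A.queries : ℝ) := by
      exact_mod_cast A.min_le_two_mul_queries hε hcomp
    rw [mvQueryComplexity, ← hA]
    linarith
  · rw [one_mul]
    exact_mod_cast Nat.sInf_le hmem
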